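/- Let $h=\prod_{i=1}^t p_i^{s_i}$ with $t\ge 1$, distinct primes $p_1,\dots,p_t$ and exponents $s_i\ge 1$, and let $\mathbb{Z}_k$ denote the ring of integers modulo $k$. For $k\ge 2$, vectors $v_1,\dots,v_d\in\mathbb{Z}_k^n$ are called unimodular if the $d\times n$ matrix with rows $v_1,\dots,v_d$ has a right inverse over $\mathbb{Z}_k$. The dimension $\dim V$ of a submodule $V\subseteq\mathbb{Z}_k^n$ is the largest number of vectors in a unimodular system of vectors of $V$, and an $m$-subspace of $\mathbb{Z}_k^n$ is a submodule that has a unimodular basis of $m$ vectors. For $2\le r\le m+1\le n$, the generalized Grassmann graph $G_r(m,n,\mathbb{Z}_k)$ has the $m$-subspaces of $\mathbb{Z}_k^n$ as vertices, two distinct vertices $A,B$ being adjacent if and only if $\dim(A\cap B)>m-r$. Let $\alpha(\Gamma)$ denote the independence number of a graph $\Gamma$, that is, the largest number of pairwise non-adjacent vertices, and let $${n\brack k}_q=\prod_{j=0}^{k-1}\frac{q^n-q^j}{q^k-q^j}.$$ **Theorem.** Let $r,m,n$ be integers with $2\le r\le m+1\le n$ and $n\ge 2m$, and put $\omega_i=(s_i-1)(n-m)(m-r+1)$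 for $i=1,\dots,t$. Then $$\prod_{i=1}^t p_i^{\omega_i}\,\alpha\bigl(G_r(m,n,\mathbb{Z}_{p_i})\bigr)\;\le\;\alpha\bigl(G_r(m,n,\mathbb{Z}_h)\bigr)\;\le\;\prod_{i=1}^t\frac{p_i^{\omega_i}{n\brack m}_{p_i}}{{n-m+r-1\brack r-1}_{p_i}}.$$ -/

import Mathlib

namespace GrassmannZMod

/-- The vectors `v₁, …, v_k` of `ℤ_h ^ n` are unimodular: the `k × n` matrix whose rows they are
has a right inverse. -/
def IsUnimodular {h n k : ℕ} (v : Fin k → Fin n → ZMod h) : Prop :=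
  ∃ B : Matrix (Fin n) (Fin k) (ZMod h), Matrix.of v * B = 1

/-- The dimension of a linear subset `V` of `ℤ_h ^ n`: the largest number of vectors in a
unimodular system of vectors of `V`. For `h ≠ 1` the vectors of a unimodular system are
linearly independent, so they are distinct and at most `n` in number; the empty system is
unimodular. -/
noncomputable def dim {h n : ℕ} (V : Submodule (ZMod h) (Fin n → ZMod h)) : ℕ :=
  sSup {k : ℕ | ∃ v : Fin k → Fin n → ZMod h, IsUnimodular v ∧ ∀ i, v i ∈ V}

/-- `X` is an `m`-subspace of `ℤ_h ^ n`: it has a basis consisting of `m` vectors which is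
unimodular. (Linear independence follows from unimodularity.) -/
def IsSubspace {h n : ℕ} (m : ℕ) (X : Submodule (ZMod h) (Fin n → ZMod h)) : Prop :=
  ∃ v : Fin m → Fin n → ZMod h, IsUnimodular v ∧ Submodule.span (ZMod h) (Set.range v) = X

/-- The set of all `m`-subspaces of `ℤ_h ^ n`, as a type. -/
abbrev Vertex (m n h : ℕ) : Type :=
  {X : Submodule (ZMod h) (Fin n → ZMod h) // IsSubspace m X}

/-- The generalized Grassmann graph `G_r(m, n, ℤ_h)`: two distinct `m`-subspaces are adjacent if
the dimension of their intersection is greater than the integer `m - r` (which is `-1` when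
`r = m + 1`; hence the subtraction-free form). -/
def grassmannGraph (r m n h : ℕ) : SimpleGraph (Vertex m n h) where
  Adj A B := A ≠ B ∧ m < dim (A.1 ⊓ B.1) + r
  symm := ⟨fun _ _ hAB => ⟨hAB.1.symm, by rw [inf_comm]; exact hAB.2⟩⟩
  loopless := ⟨fun _ hA => hA.1 rfl⟩

/-- The Gaussian binomial coefficient `[n, k]_q`, for `q ≥ 2`. -/
def gaussBinom (q n k : ℕ) : ℚ :=
  ∏ j ∈ Finset.range k, ((q : ℚ) ^ n - (q : ℚ) ^ j) / ((q : ℚ) ^ k - (q : ℚ) ^ j)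

end GrassmannZMod

/-! Put `k = m + 1 - r`. A set of vertices is independent exactly when no two distinct members share
a unimodular system of `k` vectors. Upper bound: members of an independent set own disjoint families
of such systems, all of the same size, so `indepNum_mul_numSystems_le` bounds the independence
number by the ratio of the counts for `n` and `m`. Unimodularity is detected modulo the primes
dividing `h`, hence `numSystems_mul` evaluates this ratio prime by prime. Lower bound: independent
sets over the rings `ℤ_{p_i^{s_i}}` glue by the Chinese remainder theorem (`prod_indepNum_le`). Over
`ℤ_{p^s}`, `exists_lifts` replaces each member of an independent set over `ℤ_p` by `p^((s-1)(n-m)k)`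
lifts, the row spaces of `V + p E(c) W`: `V` lifts a basis, `W` completes it, and `E` is an integral
lift of a Gabidulin code of `m × (n-m)` matrices, which needs `m ≤ n - m`. A `k`-system common to
the lifts for `c` and `d` gives an `x` of rank `k` modulo `p` with `p^(s-1)` dividing `x E(c-d)`,
which forces `c = d`. -/

namespace GrassmannZMod

open Matrix

/-! ### Unimodular systems and independent sets. -/

section Unimodular

theorem IsUnimodular.comp {h n k l : ℕ} {v : Fin l → Fin n → ZMod h} (hv : IsUnimodular v)
    {e : Fin k → Fin l} (he : Function.Injective e) : IsUnimodular (v ∘ e) := by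
  obtain ⟨B, hB⟩ := hv
  refine ⟨B.submatrix id e, ?_⟩
  have := congrArg (fun M => M.submatrix e e) hB
  simp only [submatrix_one e he] at this
  rw [← this]
  ext i j
  simp [Matrix.mul_apply]

theorem IsUnimodular.le {h n k : ℕ} (hh : 1 < h) {v : Fin k → Fin n → ZMod h}
    (hv : IsUnimodular v) : k ≤ n := by
  have : Fact (1 < h) := ⟨hh⟩
  obtain ⟨B, hB⟩ := hv
  have h1 := Matrix.rank_mul_le_left (Matrix.of v) B
  rw [hB, Matrix.rank_one, Fintype.card_fin] at h1
  exact h1.trans (by simpa using Matrix.rank_le_card_width (Matrix.of v))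

theorem IsUnimodular.map {h h' n k : ℕ} (f : ZMod h →+* ZMod h') {v : Fin k → Fin n → ZMod h}
    (hv : IsUnimodular v) : IsUnimodular (fun i => f ∘ v i) := by
  obtain ⟨B, hB⟩ := hv
  refine ⟨B.map f, ?_⟩
  have := congrArg (fun M => M.map f) hB
  simp only [Matrix.map_mul, Matrix.map_one f f.map_zero f.map_one] at this
  exact this

/-- `V` contains a unimodular system of `k` vectors. -/
def HasSystem {h n : ℕ} (k : ℕ) (V : Submodule (ZMod h) (Fin n → ZMod h)) : Prop :=
  ∃ v : Fin k → Fin n → ZMod h, IsUnimodular v ∧ ∀ i, v i ∈ V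

theorem le_dim_iff {h n k : ℕ} (hh : 1 < h) (V : Submodule (ZMod h) (Fin n → ZMod h)) :
    k ≤ dim V ↔ HasSystem k V := by
  have hbdd : BddAbove {k : ℕ | HasSystem k V} :=
    ⟨n, fun l ⟨_, hv, _⟩ => hv.le hh⟩
  constructor
  · intro hk
    have hne : {k : ℕ | HasSystem k V}.Nonempty :=
      ⟨0, fun i => i.elim0, ⟨0, Subsingleton.elim _ _⟩, fun i => i.elim0⟩
    obtain ⟨v, hv, hV⟩ := Nat.sSup_mem hne hbdd
    exact ⟨v ∘ Fin.castLE hk, hv.comp (Fin.castLE_injective hk), fun i => hV _⟩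
  · intro hk
    exact le_csSup hbdd hk

theorem not_adj_iff {r m n h : ℕ} (hh : 1 < h) (hrm : r ≤ m + 1) {A B : Vertex m n h}
    (hAB : A ≠ B) :
    ¬ (grassmannGraph r m n h).Adj A B ↔ ¬ HasSystem (m + 1 - r) (A.1 ⊓ B.1) := by
  rw [← le_dim_iff hh]
  simp only [grassmannGraph, ne_eq, hAB, not_false_eq_true, true_and]
  omega

theorem hasSystem_of_isSubspace {h n m k : ℕ} (hk : k ≤ m)
    {X : Submodule (ZMod h) (Fin n → ZMod h)} (hX : IsSubspace m X) : HasSystem k X := by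
  obtain ⟨v, hv, rfl⟩ := hX
  exact ⟨v ∘ Fin.castLE hk, hv.comp (Fin.castLE_injective hk),
    fun i => Submodule.subset_span ⟨_, rfl⟩⟩

/-- Injectivity of the family comes for free: as `r ≥ 1`, a vertex itself contains a system of `m +
1 - r` vectors, so equal members would violate `hA`. -/
theorem card_le_indepNum {r m n h : ℕ} (hh : 1 < h) (hr : 1 ≤ r) (hrm : r ≤ m + 1)
    {ι : Type*} [Fintype ι] (A : ι → Vertex m n h)
    (hA : ∀ i j, i ≠ j → ¬ HasSystem (m + 1 - r) ((A i).1 ⊓ (A j).1)) :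
    Fintype.card ι ≤ (grassmannGraph r m n h).indepNum := by
  classical
  have : NeZero h := ⟨by omega⟩
  have : Fintype (Vertex m n h) := Fintype.ofFinite _
  have hinj : Function.Injective A := by
    intro i j hij
    by_contra hne
    refine hA i j hne ?_
    rw [hij, inf_idem]
    exact hasSystem_of_isSubspace (by omega) (A j).2
  have hind : (grassmannGraph r m n h).IsIndepSet
      ((Finset.univ.map ⟨A, hinj⟩ : Finset (Vertex m n h)) : Set (Vertex m n h)) := by
    intro X hX Y hY hXY
    simp only [Finset.coe_map, Function.Embedding.coeFn_mk, Finset.coe_univ, Set.image_univ,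
      Set.mem_range] at hX hY
    obtain ⟨i, rfl⟩ := hX
    obtain ⟨j, rfl⟩ := hY
    rw [not_adj_iff hh hrm hXY]
    exact hA i j (fun e => hXY (by rw [e]))
  have := hind.card_le_indepNum
  simpa using this

theorem exists_independent {r m n h : ℕ} (hh : 1 < h) (hrm : r ≤ m + 1) :
    ∃ F : Finset (Vertex m n h), F.card = (grassmannGraph r m n h).indepNum ∧
      ∀ X ∈ F, ∀ Y ∈ F, X ≠ Y → ¬ HasSystem (m + 1 - r) (X.1 ⊓ Y.1) := by
  classical
  have : NeZero h := ⟨by omega⟩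
  have : Fintype (Vertex m n h) := Fintype.ofFinite _
  obtain ⟨F, hF⟩ := (grassmannGraph r m n h).exists_isNIndepSet_indepNum
  refine ⟨F, hF.card_eq, fun X hX Y hY hXY => ?_⟩
  rw [← not_adj_iff hh hrm hXY]
  exact hF.isIndepSet hX hY hXY

end Unimodular

/-! ### Reduction modulo divisors and the Chinese remainder theorem. -/

section Reduction

/-- The image of `A` under the coordinatewise map `f` is contained in `A'`. -/
def ReducesTo {h h' n : ℕ} (f : ZMod h →+* ZMod h') (A : Submodule (ZMod h) (Fin n → ZMod h))
    (A' : Submodule (ZMod h') (Fin n → ZMod h')) : Prop :=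
  ∀ v ∈ A, f ∘ v ∈ A'

theorem HasSystem.of_reducesTo {h h' n k : ℕ} {f : ZMod h →+* ZMod h'}
    {A B : Submodule (ZMod h) (Fin n → ZMod h)} {A' B' : Submodule (ZMod h') (Fin n → ZMod h')}
    (hA : ReducesTo f A A') (hB : ReducesTo f B B') (hAB : HasSystem k (A ⊓ B)) :
    HasSystem k (A' ⊓ B') := by
  obtain ⟨v, hv, hvAB⟩ := hAB
  exact ⟨_, hv.map f, fun i => ⟨hA _ (hvAB i).1, hB _ (hvAB i).2⟩⟩

theorem reducesTo_span {h h' n m : ℕ} (f : ZMod h →+* ZMod h') {v : Fin m → Fin n → ZMod h}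
    {v' : Fin m → Fin n → ZMod h'} (hv : ∀ i j, f (v i j) = v' i j) :
    ReducesTo f (Submodule.span _ (Set.range v)) (Submodule.span _ (Set.range v')) := by
  intro w hw
  induction hw using Submodule.span_induction with
  | mem x hx =>
    obtain ⟨i, rfl⟩ := hx
    exact Submodule.subset_span ⟨i, by ext j; simp [hv]⟩
  | zero => convert Submodule.zero_mem _; ext; simp
  | add x y _ _ hx hy => convert Submodule.add_mem _ hx hy using 1; ext; simp
  | smul a x _ hx => convert Submodule.smul_mem _ (f a) hx using 1; ext; simp

/-- A non-unit shares a prime with `h`, and `hrad` places that prime in some `p i`. The `p i` need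
not be prime: they are later both the primes and the full prime powers. -/
theorem isUnit_of_forall_castHom {ι : Type*} {h : ℕ} [NeZero h] {p : ι → ℕ} (hd : ∀ i, p i ∣ h)
    (hrad : ∀ q : ℕ, q.Prime → q ∣ h → ∃ i, q ∣ p i) {x : ZMod h}
    (hx : ∀ i, IsUnit (ZMod.castHom (hd i) (ZMod (p i)) x)) : IsUnit x := by
  obtain ⟨a, rfl⟩ := ZMod.natCast_zmod_surjective x
  rw [ZMod.isUnit_iff_coprime]
  refine Nat.coprime_of_dvd fun q hq hqa hqh => ?_
  obtain ⟨i, hi⟩ := hrad q hq hqh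
  have := hx i
  rw [map_natCast, ZMod.isUnit_iff_coprime] at this
  exact hq.one_lt.ne' (Nat.dvd_one.1 (this ▸ Nat.dvd_gcd hqa hi))

theorem exists_castHom_eq {ι : Type*} [Fintype ι] {h : ℕ} {p : ι → ℕ}
    (hc : Pairwise fun i j => (p i).Coprime (p j)) (hd : ∀ i, p i ∣ h) (y : ∀ i, ZMod (p i)) :
    ∃ x : ZMod h, ∀ i, ZMod.castHom (hd i) (ZMod (p i)) x = y i := by
  have hP : ∏ i, p i ∣ h :=
    Finset.prod_dvd_of_isRelPrime
      (fun i _ j _ hij => Nat.coprime_iff_isRelPrime.1 (hc hij)) fun i _ => hd i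
  obtain ⟨x, hx⟩ := ZMod.castHom_surjective hP ((ZMod.prodEquivPi p hc).symm y)
  refine ⟨x, fun i => ?_⟩
  have h1 : ZMod.prodEquivPi p hc (ZMod.castHom hP (ZMod (∏ i, p i)) x) i = y i := by
    rw [hx, RingEquiv.apply_symm_apply]
  rw [← h1, ZMod.prodEquivPi_apply, ← RingHom.comp_apply]
  exact RingHom.congr_fun (Subsingleton.elim _ _) x

theorem exists_rightInverse_of_forall_castHom {ι κ μ : Type*} [Fintype ι] [Fintype κ] [Fintype μ]
    [DecidableEq κ] {h : ℕ} [NeZero h]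
    {p : ι → ℕ} (hc : Pairwise fun i j => (p i).Coprime (p j)) (hd : ∀ i, p i ∣ h)
    (hrad : ∀ q : ℕ, q.Prime → q ∣ h → ∃ i, q ∣ p i) (M : Matrix κ μ (ZMod h))
    (hM : ∀ i, ∃ B : Matrix μ κ (ZMod (p i)),
      M.map (ZMod.castHom (hd i) (ZMod (p i))) * B = 1) :
    ∃ B : Matrix μ κ (ZMod h), M * B = 1 := by
  choose B hB using hM
  choose C hC using fun a b => exists_castHom_eq hc hd (fun i => B i a b)
  -- The glued `C` need only be a right inverse modulo each `p i`; invertibility of `M * C` lets it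
  -- be corrected to an exact one.
  have hu : IsUnit (M * Matrix.of C).det := by
    refine isUnit_of_forall_castHom hd hrad fun i => ?_
    rw [RingHom.map_det, RingHom.mapMatrix_apply, Matrix.map_mul]
    have : (Matrix.of C).map (ZMod.castHom (hd i) (ZMod (p i))) = B i := by
      ext a b; exact hC a b i
    rw [this, hB]
    simp
  exact ⟨Matrix.of C * (M * Matrix.of C)⁻¹, by
    rw [← Matrix.mul_assoc, Matrix.mul_nonsing_inv _ hu]⟩

theorem isUnimodular_iff_forall_castHom {ι : Type*} [Fintype ι] {h n k : ℕ} [NeZero h]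
    {p : ι → ℕ} (hc : Pairwise fun i j => (p i).Coprime (p j)) (hd : ∀ i, p i ∣ h)
    (hrad : ∀ q : ℕ, q.Prime → q ∣ h → ∃ i, q ∣ p i) (v : Fin k → Fin n → ZMod h) :
    IsUnimodular v ↔ ∀ i, IsUnimodular fun a => ZMod.castHom (hd i) (ZMod (p i)) ∘ v a :=
  ⟨fun hv _ => hv.map _, fun hv =>
    exists_rightInverse_of_forall_castHom hc hd hrad (Matrix.of v) hv⟩

end Reduction

/-! ### Right inverses over a field. -/

section Field

theorem exists_rightInverse_of_linearIndependent {K κ μ : Type*} [Field K] [Fintype κ] [Fintype μ]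
    [DecidableEq κ] (M : Matrix κ μ K) (hM : LinearIndependent K M.row) :
    ∃ B : Matrix μ κ K, M * B = 1 := by
  classical
  have hinj := Matrix.vecMul_injective_iff.2 hM
  obtain ⟨g, hg⟩ := M.vecMulLinear.exists_leftInverse_of_injective (LinearMap.ker_eq_bot.2 hinj)
  refine ⟨Matrix.of fun j => g (Pi.single j 1), ?_⟩
  ext a b
  have h1 := congrFun (LinearMap.congr_fun hg (Pi.single a 1)) b
  have h2 : g (M a) = ∑ j, M a j • g (Pi.single j 1) := by
    conv_lhs => rw [pi_eq_sum_univ' (M a)]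
    simp
  simp only [LinearMap.comp_apply, Matrix.vecMulLinear_apply, Matrix.single_one_vecMul,
    LinearMap.id_apply] at h1
  rw [show M.row a = M a from rfl, h2] at h1
  simp only [Finset.sum_apply, Pi.smul_apply, smul_eq_mul] at h1
  rw [Matrix.mul_apply]
  simp only [Matrix.of_apply]
  rw [h1, Matrix.one_apply, Pi.single_apply]
  simp [eq_comm]

theorem linearIndependent_of_rightInverse {R κ μ : Type*} [CommRing R] [Fintype κ] [Fintype μ]
    [DecidableEq κ] {M : Matrix κ μ R} {B : Matrix μ κ R} (hB : M * B = 1) :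
    LinearIndependent R M.row := by
  rw [← Matrix.vecMul_injective_iff]
  intro x y hxy
  have := congrArg (fun z => z ᵥ* B) hxy
  simpa [Matrix.vecMul_vecMul, hB] using this

theorem isUnimodular_iff_linearIndependent {p n k : ℕ} [Fact p.Prime]
    (v : Fin k → Fin n → ZMod p) : IsUnimodular v ↔ LinearIndependent (ZMod p) v :=
  ⟨fun ⟨_, hB⟩ => linearIndependent_of_rightInverse hB,
    fun hv => exists_rightInverse_of_linearIndependent (Matrix.of v) hv⟩

end Field

/-! ### Counting unimodular systems; the double count. -/

section Counting

/-- All fibres of `f` are cosets of its kernel, hence equally large. -/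
theorem card_subtype_comp {G H : Type*} [AddGroup G] [AddGroup H] [Finite G] [Finite H]
    (f : G →+ H) (hf : Function.Surjective f) (P : H → Prop) :
    Nat.card {g : G // P (f g)} * Nat.card H = Nat.card {x : H // P x} * Nat.card G := by
  have key : ∀ P : H → Prop,
      Nat.card {g : G // P (f g)} = Nat.card {x : H // P x} * Nat.card f.ker := by
    intro P
    rw [← Nat.card_prod]
    refine Nat.card_congr ?_
    choose s hs using hf
    exact
      { toFun := fun g => (⟨f g.1, g.2⟩, ⟨-s (f g.1) + g.1, by simp [AddMonoidHom.mem_ker, hs]⟩)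
        invFun := fun x => ⟨s x.1.1 + x.2.1, by
          rw [map_add, hs, (AddMonoidHom.mem_ker.1 x.2.2), add_zero]; exact x.1.2⟩
        left_inv := fun g => by simp
        right_inv := fun x => by
          obtain ⟨⟨x, hx⟩, ⟨y, hy⟩⟩ := x
          have hy' : f y = 0 := hy
          ext <;> simp [hs, hy'] }
  have h1 := key fun _ => True
  have h2 := key P
  rw [Nat.card_congr (Equiv.subtypeUnivEquiv fun _ => trivial),
    Nat.card_congr (Equiv.subtypeUnivEquiv fun _ => trivial)] at h1
  rw [h1, h2]
  ring

/-- The number of unimodular systems of `k` vectors of `ℤ_h ^ n`. -/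
noncomputable def numSystems (h k n : ℕ) : ℕ :=
  Nat.card {v : Fin k → Fin n → ZMod h // IsUnimodular v}

theorem numSystems_prime {p k n : ℕ} [Fact p.Prime] (hkn : k ≤ n) :
    numSystems p k n = ∏ j : Fin k, (p ^ n - p ^ (j : ℕ)) := by
  have := card_linearIndependent (K := ZMod p) (V := Fin n → ZMod p) (k := k) (by simpa using hkn)
  simp only [Module.finrank_fintype_fun_eq_card, Fintype.card_fin, ZMod.card] at this
  rw [← this]
  exact Nat.card_congr (Equiv.subtypeEquivRight isUnimodular_iff_linearIndependent)

theorem numSystems_mul {ι : Type*} [Fintype ι] {h k n : ℕ} [NeZero h] {p : ι → ℕ}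
    (hp0 : ∀ i, p i ≠ 0)
    (hc : Pairwise fun i j => (p i).Coprime (p j)) (hd : ∀ i, p i ∣ h)
    (hrad : ∀ q : ℕ, q.Prime → q ∣ h → ∃ i, q ∣ p i) :
    numSystems h k n * (∏ i, p i) ^ (k * n) = (∏ i, numSystems (p i) k n) * h ^ (k * n) := by
  have (i : ι) : NeZero (p i) := ⟨hp0 i⟩
  let f : (Fin k → Fin n → ZMod h) →+ (∀ i, Fin k → Fin n → ZMod (p i)) :=
    { toFun := fun v i a b => ZMod.castHom (hd i) (ZMod (p i)) (v a b)
      map_zero' := by ext; simp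
      map_add' := fun v w => by ext; simp only [Pi.add_apply, map_add] }
  have hf : Function.Surjective f := by
    intro w
    choose v hv using fun a b => exists_castHom_eq hc hd (fun i => w i a b)
    exact ⟨v, by ext i a b; exact hv a b i⟩
  have := card_subtype_comp f hf fun w => ∀ i, IsUnimodular (w i)
  have e1 : Nat.card {v // ∀ i, IsUnimodular (f v i)} = numSystems h k n :=
    Nat.card_congr (Equiv.subtypeEquivRight fun v =>
      (isUnimodular_iff_forall_castHom hc hd hrad v).symm)
  have e2 : Nat.card {w : ∀ i, Fin k → Fin n → ZMod (p i) // ∀ i, IsUnimodular (w i)} =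
      ∏ i, numSystems (p i) k n := by
    rw [Nat.card_congr (Equiv.subtypePiEquivPi
      (p := fun i (v : Fin k → Fin n → ZMod (p i)) => IsUnimodular v)), Nat.card_pi]
    rfl
  rw [e1, e2] at this
  simpa [Nat.card_pi, Nat.card_fun, ← pow_mul, mul_comm n k, Finset.prod_pow] using this

/-- The unimodular systems of `k` vectors of an `m`-subspace correspond to those of
`ℤ_h ^ m`. -/
theorem card_systems_isSubspace {h m n k : ℕ} {X : Submodule (ZMod h) (Fin n → ZMod h)}
    (hX : IsSubspace m X) :
    Nat.card {v : Fin k → Fin n → ZMod h // IsUnimodular v ∧ ∀ i, v i ∈ X} = numSystems h k m := by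
  obtain ⟨w, ⟨B, hB⟩, rfl⟩ := hX
  have hmem : ∀ x : Fin n → ZMod h, x ∈ Submodule.span (ZMod h) (Set.range w) ↔
      ∃ c : Fin m → ZMod h, c ᵥ* Matrix.of w = x := by
    intro x
    have := range_vecMulLinear (Matrix.of w)
    change _ = Submodule.span _ (Set.range w) at this
    rw [← this, LinearMap.mem_range]
    rfl
  symm
  refine Nat.card_congr (Equiv.ofBijective
    (fun c => ⟨fun i => c.1 i ᵥ* Matrix.of w, ?_, fun i => (hmem _).2 ⟨_, rfl⟩⟩) ⟨?_, ?_⟩)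
  · obtain ⟨c, D, hD⟩ := c
    refine ⟨B * D, ?_⟩
    change Matrix.of c * Matrix.of w * (B * D) = 1
    rw [Matrix.mul_assoc, ← Matrix.mul_assoc _ B, hB, Matrix.one_mul, hD]
  · intro c d hcd
    ext1
    have h1 : Matrix.of c.1 * Matrix.of w = Matrix.of d.1 * Matrix.of w :=
      congrArg (fun z => Matrix.of z.1) hcd
    have h2 := congrArg (fun M => M * B) h1
    simp only [Matrix.mul_assoc, hB, Matrix.mul_one] at h2
    exact h2
  · rintro ⟨v, ⟨D, hD⟩, hv⟩
    choose c hc using fun i => (hmem _).1 (hv i)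
    refine ⟨⟨c, Matrix.of w * D, ?_⟩, ?_⟩
    · rw [← Matrix.mul_assoc, ← hD]
      congr 1
      ext i j
      exact congrFun (hc i) j
    · ext i j
      exact congrFun (hc i) j

/-- A system lies in at most one member of an independent set, so forgetting the member is injective
on pairs (member, system). -/
theorem indepNum_mul_numSystems_le {r m n h : ℕ} (hh : 1 < h) (hrm : r ≤ m + 1) :
    (grassmannGraph r m n h).indepNum * numSystems h (m + 1 - r) m ≤
      numSystems h (m + 1 - r) n := by
  have : NeZero h := ⟨by omega⟩
  obtain ⟨F, hF, hFind⟩ := exists_independent (n := n) hh hrm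
  have key : Function.Injective
      (fun x : Σ X : F, {v : Fin (m + 1 - r) → Fin n → ZMod h //
        IsUnimodular v ∧ ∀ i, v i ∈ X.1.1} =>
      (⟨x.2.1, x.2.2.1⟩ : {v : Fin (m + 1 - r) → Fin n → ZMod h // IsUnimodular v})) := by
    rintro ⟨⟨X, hX⟩, v, hv, hvX⟩ ⟨⟨Y, hY⟩, w, hw, hwY⟩ hvw
    obtain rfl : v = w := congrArg Subtype.val hvw
    obtain rfl : X = Y := by
      by_contra hne
      exact hFind X hX Y hY hne ⟨v, hv, fun i => ⟨hvX i, hwY i⟩⟩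
    rfl
  have := Nat.card_le_card_of_injective _ key
  rw [Nat.card_sigma] at this
  simp only [fun X : F => card_systems_isSubspace (k := m + 1 - r) X.1.2] at this
  simpa [hF, numSystems] using this

/-- The factors with index at least `k` in the numerator reproduce the denominator once `q^k` is
cancelled. What remains is the ratio of system counts at the prime `q`. -/
theorem gaussBinom_div {q m n k : ℕ} (hq : 1 < q) (hkm : k ≤ m) (hmn : m ≤ n) :
    gaussBinom q n m / gaussBinom q (n - k) (m - k) =
      ∏ j ∈ Finset.range k, ((q : ℚ) ^ n - (q : ℚ) ^ j) / ((q : ℚ) ^ m - (q : ℚ) ^ j) := by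
  obtain ⟨l, rfl⟩ := Nat.exists_eq_add_of_le hkm
  obtain ⟨d, rfl⟩ := Nat.exists_eq_add_of_le hmn
  have hq' : (1 : ℚ) < q := by exact_mod_cast hq
  have hq0 : (q : ℚ) ≠ 0 := by positivity
  have hne : gaussBinom q (l + d) l ≠ 0 := by
    refine Finset.prod_ne_zero_iff.2 fun j hj => ?_
    have hj := Finset.mem_range.1 hj
    exact div_ne_zero (sub_pos.2 (pow_lt_pow_right₀ hq' (by omega))).ne'
      (sub_pos.2 (pow_lt_pow_right₀ hq' (by omega))).ne'
  rw [show k + l + d - k = l + d by omega, show k + l - k = l by omega, div_eq_iff hne, gaussBinom,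
    Finset.prod_range_add]
  congr 1
  refine Finset.prod_congr rfl fun j _ => ?_
  rw [add_assoc, pow_add _ k, pow_add _ k, pow_add _ k, ← mul_sub, ← mul_sub,
    mul_div_mul_left _ _ (pow_ne_zero _ hq0)]

theorem cast_numSystems_prime {p k n : ℕ} [hp : Fact p.Prime] (hkn : k ≤ n) :
    (numSystems p k n : ℚ) = ∏ j ∈ Finset.range k, ((p : ℚ) ^ n - (p : ℚ) ^ j) := by
  rw [numSystems_prime hkn, Nat.cast_prod, ← Fin.prod_univ_eq_prod_range
    (fun j => (p : ℚ) ^ n - (p : ℚ) ^ j)]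
  refine Finset.prod_congr rfl fun j _ => ?_
  rw [Nat.cast_sub (Nat.pow_le_pow_right hp.out.pos (by omega))]
  push_cast
  rfl

theorem numSystems_prime_pos {p k n : ℕ} [hp : Fact p.Prime] (hkn : k ≤ n) :
    0 < numSystems p k n := by
  rw [numSystems_prime hkn]
  exact Finset.prod_pos fun j _ =>
    Nat.sub_pos_of_lt (Nat.pow_lt_pow_right hp.out.one_lt (by omega))

end Counting

/-! ### The upper bound, assembled over the prime factors. -/

section PrimeFactors

theorem pairwise_coprime_of_injective {ι : Type*} {p : ι → ℕ}
    (hp : ∀ i, (p i).Prime) (hinj : Function.Injective p) :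
    Pairwise fun i j => (p i).Coprime (p j) :=
  fun i j hij => (Nat.coprime_primes (hp i) (hp j)).2 fun e => hij (hinj e)

variable {ι : Type*} [Fintype ι] {p s : ι → ℕ}

theorem dvd_prod_pow (hs : ∀ i, 1 ≤ s i) (i : ι) : p i ∣ ∏ i, p i ^ s i :=
  (dvd_pow_self _ (by have := hs i; omega)).trans (Finset.dvd_prod_of_mem _ (Finset.mem_univ i))

theorem exists_dvd_of_dvd_prod_pow {q : ℕ} (hq : q.Prime) (hd : q ∣ ∏ i, p i ^ s i) :
    ∃ i, q ∣ p i := by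
  obtain ⟨i, _, hi⟩ := (hq.prime.dvd_finsetProd_iff _).1 hd
  exact ⟨i, hq.dvd_of_dvd_pow hi⟩

theorem one_lt_prod_pow [Nonempty ι] (hp : ∀ i, (p i).Prime) (hs : ∀ i, 1 ≤ s i) :
    1 < ∏ i, p i ^ s i := by
  have i : ι := Classical.arbitrary ι
  exact (hp i).one_lt.trans_le (Nat.le_of_dvd
    (Finset.prod_pos fun i _ => pow_pos (hp i).pos _) (dvd_prod_pow hs i))

theorem indepNum_le [Nonempty ι] (hp : ∀ i, (p i).Prime) (hinj : Function.Injective p)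
    (hs : ∀ i, 1 ≤ s i) {r m n : ℕ} (hr : 1 ≤ r) (hrm : r ≤ m + 1) (hmn : m ≤ n) :
    ((grassmannGraph r m n (∏ i, p i ^ s i)).indepNum : ℚ) ≤
      ∏ i, ((p i : ℚ) ^ ((s i - 1) * (n - m) * (m + 1 - r)) *
          gaussBinom (p i) n m / gaussBinom (p i) (n - m + r - 1) (r - 1)) := by
  have (i : ι) : Fact (p i).Prime := ⟨hp i⟩
  set h := ∏ i, p i ^ s i with hh
  set k := m + 1 - r with hk
  have h1 : 1 < h := one_lt_prod_pow hp hs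
  have : NeZero h := ⟨by omega⟩
  have hcount (l : ℕ) := numSystems_mul (k := k) (n := l) (fun i => (hp i).ne_zero)
    (pairwise_coprime_of_injective hp hinj) (dvd_prod_pow hs)
    (fun q hq hd => exists_dvd_of_dvd_prod_pow hq hd)
  have hcount' (l : ℕ) (hl : k ≤ l) : (numSystems h k l : ℚ) =
      ∏ i, ((p i : ℚ) ^ ((s i - 1) * (k * l)) *
        ∏ j ∈ Finset.range k, ((p i : ℚ) ^ l - (p i : ℚ) ^ j)) := by
    have hpos : (∏ i, (p i : ℚ)) ^ (k * l) ≠ 0 :=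
      pow_ne_zero _ (Finset.prod_ne_zero_iff.2 fun i _ => by exact_mod_cast (hp i).ne_zero)
    have := congrArg (Nat.cast : ℕ → ℚ) (hcount l)
    push_cast at this
    refine mul_right_cancel₀ hpos (this.trans ?_)
    rw [← Finset.prod_pow, ← Finset.prod_pow, ← Finset.prod_mul_distrib,
      ← Finset.prod_mul_distrib]
    refine Finset.prod_congr rfl fun i _ => ?_
    obtain ⟨a, ha⟩ := Nat.exists_eq_add_of_le (hs i)
    rw [cast_numSystems_prime hl, ha, Nat.add_sub_cancel_left]
    ring
  have hdiv : (∏ i, ((p i : ℚ) ^ ((s i - 1) * (n - m) * k) *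
      gaussBinom (p i) n m / gaussBinom (p i) (n - m + r - 1) (r - 1))) * numSystems h k m =
      numSystems h k n := by
    rw [hcount' m (by omega), hcount' n (by omega), ← Finset.prod_mul_distrib]
    refine Finset.prod_congr rfl fun i _ => ?_
    have hp1 : (1 : ℚ) < p i := by exact_mod_cast (hp i).one_lt
    have hne : ∏ j ∈ Finset.range k, ((p i : ℚ) ^ m - (p i : ℚ) ^ j) ≠ 0 :=
      Finset.prod_ne_zero_iff.2 fun j hj =>
        (sub_pos.2 (pow_lt_pow_right₀ hp1 (by have := Finset.mem_range.1 hj; omega))).ne'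
    have := gaussBinom_div (k := k) (hp i).one_lt (show k ≤ m by omega) hmn
    rw [show n - m + r - 1 = n - k by omega, show r - 1 = m - k by omega, mul_div_assoc, this,
      Finset.prod_div_distrib]
    -- The kernels of reduction for `n` and `m` contribute these powers of `p i`; their quotient is
    -- the stated power.
    have he : (s i - 1) * (k * n) = (s i - 1) * (n - m) * k + (s i - 1) * (k * m) := by
      obtain ⟨d, rfl⟩ := Nat.exists_eq_add_of_le hmn
      rw [Nat.add_sub_cancel_left]
      ring
    rw [he, pow_add]
    field_simp
  have hpos : (0 : ℚ) < numSystems h k m := by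
    rw [hcount' m (by omega)]
    refine Finset.prod_pos fun i _ => mul_pos (pow_pos (by exact_mod_cast (hp i).pos) _) ?_
    rw [← cast_numSystems_prime (by omega)]
    exact_mod_cast numSystems_prime_pos (by omega)
  refine le_of_mul_le_mul_right ?_ hpos
  rw [hdiv]
  exact_mod_cast indepNum_mul_numSystems_le h1 hrm

end PrimeFactors

/-! ### Gabidulin codes and their integral lifts. -/

section RankCode

open Polynomial in
/-- A `p`-polynomial of `p`-degree less than `k` that vanishes at `k` linearly independent
elements is zero. -/
theorem eq_zero_of_linearized {p k : ℕ} [hp : Fact p.Prime] {L : Type*} [Field L]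
    [Algebra (ZMod p) L] (f : Fin k → L) (b : Fin k → L) (hb : LinearIndependent (ZMod p) b)
    (hf : ∀ i, ∑ j, f j * b i ^ p ^ (j : ℕ) = 0) : f = 0 := by
  classical
  have : CharP L p := charP_of_injective_algebraMap (algebraMap (ZMod p) L).injective p
  have : ExpChar L p := ExpChar.prime hp.out
  let P : L[X] := ∑ j, C (f j) * X ^ p ^ (j : ℕ)
  let φ : L →ₗ[ZMod p] L :=
    { toFun := fun x => ∑ j, f j * x ^ p ^ (j : ℕ)
      map_add' := fun x y => by
        simp only [add_pow_expChar_pow, mul_add, Finset.sum_add_distrib]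
      map_smul' := fun c x => by
        simp only [RingHom.id_apply, Finset.smul_sum, _root_.smul_pow, ZMod.pow_card_pow,
          mul_smul_comm] }
  have hφ : ∀ c : Fin k → ZMod p, φ (∑ i, c i • b i) = 0 := fun c => by
    rw [map_sum]
    exact Finset.sum_eq_zero fun i _ => by
      rw [map_smul, show φ (b i) = 0 from hf i, smul_zero]
  have hinj : Function.Injective fun c : Fin k → ZMod p => ∑ i, c i • b i := by
    have := linearIndependent_iff_injective_fintypeLinearCombination.1 hb
    intro c d hcd
    exact this (by simpa [Fintype.linearCombination_apply] using hcd)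
  have hP : P = 0 := by
    -- By linearity `P` vanishes on the whole span of `b`: `p^k` roots against degree at most
    -- `p^(k-1)`; for `k = 0` the sum is empty.
    refine Polynomial.eq_zero_of_natDegree_lt_card_of_eval_eq_zero P hinj (fun c => ?_) ?_
    · refine Eq.trans ?_ (hφ c)
      simp only [P, eval_finsetSum, eval_mul, eval_C, eval_pow, eval_X]
      rfl
    · rw [Fintype.card_fun, ZMod.card, Fintype.card_fin]
      rcases Nat.eq_zero_or_pos k with rfl | hk
      · simp [P]
      · refine lt_of_le_of_lt (natDegree_sum_le_of_forall_le (n := p ^ (k - 1)) _ _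
          fun j _ => (natDegree_C_mul_X_pow_le _ _).trans
            (Nat.pow_le_pow_right hp.out.pos (by omega)))
          (Nat.pow_lt_pow_right hp.out.one_lt (by omega))
  ext j
  have := congrArg (fun Q => Polynomial.coeff Q (p ^ (j : ℕ))) hP
  simp only [P, finsetSum_coeff, coeff_C_mul, coeff_X_pow, coeff_zero] at this
  rw [Finset.sum_eq_single j] at this
  · simpa using this
  · intro i _ hij
    rw [if_neg, mul_zero]
    intro e
    exact hij (Fin.ext (Nat.pow_right_injective hp.out.two_le e).symm)
  · simp

/-- Gabidulin's construction: a codeword lists the coordinates of a `p`-polynomial at `m`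
independent points. By Frobenius linearity, a rank-`k` matrix `x` killing it yields `k` independent
zeros. -/
theorem exists_rank_code_of_basis {p : ℕ} [hp : Fact p.Prime] {m l : ℕ} (hml : m ≤ l) (k : ℕ)
    {L : Type*} [Field L] [Algebra (ZMod p) L] (β : Module.Basis (Fin l) (ZMod p) L) :
    ∃ C : (Fin (l * k) → ZMod p) →ₗ[ZMod p] Matrix (Fin m) (Fin l) (ZMod p),
      ∀ c, ∀ x : Matrix (Fin k) (Fin m) (ZMod p),
        (∃ B : Matrix (Fin m) (Fin k) (ZMod p), x * B = 1) → x * C c = 0 → c = 0 := by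
  classical
  have : FiniteDimensional (ZMod p) L := β.finiteDimensional_of_finite
  have hfin : Module.finrank (ZMod p) L = l := by
    rw [Module.finrank_eq_card_basis β, Fintype.card_fin]
  let a : Fin m → L := fun i => β (Fin.castLE hml i)
  have ha : LinearIndependent (ZMod p) a :=
    β.linearIndependent.comp _ (Fin.castLE_injective hml)
  let e : (Fin (l * k) → ZMod p) ≃ₗ[ZMod p] (Fin k → L) :=
    LinearEquiv.ofFinrankEq _ _ (by
      rw [Module.finrank_pi_fintype, Module.finrank_pi_fintype]
      simp [hfin, mul_comm])
  let ev : (Fin k → L) →ₗ[ZMod p] Matrix (Fin m) (Fin l) (ZMod p) :=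
    { toFun := fun f => Matrix.of fun i b => β.repr (∑ j, f j * a i ^ p ^ (j : ℕ)) b
      map_add' := fun f g => by
        ext i b
        simp [add_mul, Finset.sum_add_distrib]
      map_smul' := fun c f => by
        ext i b
        simp [← Finset.smul_sum] }
  refine ⟨ev ∘ₗ e.toLinearMap, fun c x hx hxc => ?_⟩
  obtain ⟨B, hB⟩ := hx
  rw [← e.map_eq_zero_iff]
  refine eq_zero_of_linearized (p := p) (e c) (fun i => ∑ u, x i u • a u) ?_ fun i => ?_
  · have hrow := Matrix.vecMul_injective_iff.2 (linearIndependent_of_rightInverse hB)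
    rw [linearIndependent_iff_injective_fintypeLinearCombination] at ha ⊢
    have hcomp : (Fintype.linearCombination (ZMod p) fun i => ∑ u, x i u • a u) =
        (Fintype.linearCombination (ZMod p) a) ∘ₗ x.vecMulLinear := by
      ext i
      simp [Fintype.linearCombination_apply]
    rw [hcomp]
    exact ha.comp hrow
  · have : CharP L p := charP_of_injective_algebraMap (algebraMap (ZMod p) L).injective p
    have : ExpChar L p := ExpChar.prime hp.out
    have h1 : ∑ j, e c j * (∑ u, x i u • a u) ^ p ^ (j : ℕ) =
        ∑ u, x i u • ∑ j, e c j * a u ^ p ^ (j : ℕ) := by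
      simp only [sum_pow_char_pow, smul_pow, ZMod.pow_card_pow, Finset.mul_sum, Finset.smul_sum,
        mul_smul_comm]
      exact Finset.sum_comm
    rw [h1]
    refine β.repr.map_eq_zero_iff.1 ?_
    ext b
    have h2 := congrFun (congrFun hxc i) b
    rw [Matrix.mul_apply] at h2
    simpa [ev] using h2

/-- A linear code of `m × l` matrices with dimension `l * k` in which no nonzero codeword is
annihilated on the left by a `k × m` matrix of rank `k`. -/
theorem exists_rank_code (p : ℕ) [hp : Fact p.Prime] {m l : ℕ} (hl : l ≠ 0) (hml : m ≤ l) (k : ℕ) :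
    ∃ C : (Fin (l * k) → ZMod p) →ₗ[ZMod p] Matrix (Fin m) (Fin l) (ZMod p),
      ∀ c, ∀ x : Matrix (Fin k) (Fin m) (ZMod p),
        (∃ B : Matrix (Fin m) (Fin k) (ZMod p), x * B = 1) → x * C c = 0 → c = 0 :=
  exists_rank_code_of_basis hml k
    (Module.finBasisOfFinrankEq (ZMod p) (GaloisField p l) (GaloisField.finrank p hl))

/-- An integral lift of a rank code: the condition lifts to all powers of `p`. -/
theorem exists_integral_rank_code (p : ℕ) [hp : Fact p.Prime] {m l : ℕ} (hl : l ≠ 0) (hml : m ≤ l)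
    (k : ℕ) :
    ∃ E : (Fin (l * k) → ℤ) →ₗ[ℤ] Matrix (Fin m) (Fin l) ℤ,
      ∀ x : Matrix (Fin k) (Fin m) ℤ,
      (∃ B : Matrix (Fin m) (Fin k) (ZMod p), x.map (Int.cast : ℤ → ZMod p) * B = 1) →
      ∀ (e : ℕ) (d : Fin (l * k) → ℤ), (∀ i j, (p : ℤ) ^ e ∣ (x * E d) i j) →
        ∀ b, (p : ℤ) ^ e ∣ d b := by
  classical
  obtain ⟨C, hC⟩ := exists_rank_code p hl hml k
  choose D hD using fun (b : Fin (l * k)) (i : Fin m) (j : Fin l) =>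
    ZMod.intCast_surjective (C (Pi.single b 1) i j)
  let E : (Fin (l * k) → ℤ) →ₗ[ℤ] Matrix (Fin m) (Fin l) ℤ :=
    Fintype.linearCombination ℤ fun b => Matrix.of (D b)
  have hE : ∀ d : Fin (l * k) → ℤ,
      (E d).map (Int.cast : ℤ → ZMod p) = C fun b => (d b : ZMod p) := by
    intro d
    have : (fun b => (d b : ZMod p)) = ∑ b, (d b : ZMod p) • Pi.single b (1 : ZMod p) :=
      pi_eq_sum_univ' _
    rw [this, map_sum]
    ext i j
    simp [E, Fintype.linearCombination_apply, Matrix.sum_apply, hD]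
  refine ⟨E, fun x hx e => ?_⟩
  -- Divide `d` by `p^e`, then apply the code property modulo `p` to gain one more factor.
  induction e with
  | zero => simp
  | succ e ih =>
    intro d hd
    choose d' hd' using ih d fun i j => (pow_dvd_pow _ (Nat.le_succ e)).trans (hd i j)
    obtain rfl : d = (p : ℤ) ^ e • d' := by ext b; simp [hd']
    have hpe : (p : ℤ) ^ e ≠ 0 := pow_ne_zero _ (by exact_mod_cast hp.out.ne_zero)
    have hzero : x.map (Int.cast : ℤ → ZMod p) * C (fun b => (d' b : ZMod p)) = 0 := by
      rw [← hE]
      have : (x * E d').map (Int.castRingHom (ZMod p)) = 0 := by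
        ext i j
        have := hd i j
        rw [map_smul, Matrix.mul_smul, Matrix.smul_apply, smul_eq_mul, pow_succ,
          mul_dvd_mul_iff_left hpe] at this
        simpa [ZMod.intCast_zmod_eq_zero_iff_dvd] using this
      rw [Matrix.map_mul] at this
      exact this
    have h0 := hC _ _ hx hzero
    intro b
    have := congrFun h0 b
    rw [Pi.zero_apply, ZMod.intCast_zmod_eq_zero_iff_dvd] at this
    rw [Pi.smul_apply, smul_eq_mul, pow_succ]
    exact mul_dvd_mul_left _ this

end RankCode

/-! ### The lower bound: gluing and lifting. -/

section Lifting

/-- Distinct tuples differ in some coordinate, and a system common to their glued subspaces would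
reduce to a common one there. -/
theorem prod_indepNum_le {ι : Type*} [Fintype ι] [Nonempty ι] {p s : ι → ℕ}
    (hp : ∀ i, (p i).Prime) (hinj : Function.Injective p) (hs : ∀ i, 1 ≤ s i) {r m n : ℕ}
    (hr : 1 ≤ r) (hrm : r ≤ m + 1) :
    ∏ i, (grassmannGraph r m n (p i ^ s i)).indepNum ≤
      (grassmannGraph r m n (∏ i, p i ^ s i)).indepNum := by
  classical
  have h1 : 1 < ∏ i, p i ^ s i := one_lt_prod_pow hp hs
  have : NeZero (∏ i, p i ^ s i) := ⟨by omega⟩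
  have hq (i : ι) : 1 < p i ^ s i := Nat.one_lt_pow (by have := hs i; omega) (hp i).one_lt
  have hc : Pairwise fun i j => (p i ^ s i).Coprime (p j ^ s j) :=
    fun i j hij => Nat.Coprime.pow _ _ (pairwise_coprime_of_injective hp hinj hij)
  have hd (i : ι) : p i ^ s i ∣ ∏ i, p i ^ s i := Finset.dvd_prod_of_mem _ (Finset.mem_univ i)
  have hrad (q : ℕ) (hqp : q.Prime) (hqd : q ∣ ∏ i, p i ^ s i) : ∃ i, q ∣ p i ^ s i := by
    obtain ⟨i, hi⟩ := exists_dvd_of_dvd_prod_pow hqp hqd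
    exact ⟨i, hi.trans (dvd_pow_self _ (by have := hs i; omega))⟩
  choose F hF hFind using fun i => exists_independent (m := m) (n := n) (hq i) hrm
  have hlift (X : ∀ i, F i) : ∃ A : Vertex m n (∏ i, p i ^ s i),
      ∀ i, ReducesTo (ZMod.castHom (hd i) (ZMod (p i ^ s i))) A.1 (X i).1.1 := by
    choose v hv hvX using fun i => (X i).1.2
    choose w hw using fun a b => exists_castHom_eq hc hd fun i => v i a b
    refine ⟨⟨_, w, (isUnimodular_iff_forall_castHom hc hd hrad w).2 fun i => ?_, rfl⟩,
      fun i => ?_⟩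
    · convert hv i using 1
      ext a b
      exact hw a b i
    · rw [← hvX i]
      exact reducesTo_span _ fun a b => hw a b i
  choose A hA using hlift
  have := card_le_indepNum h1 hr hrm A fun X Y hXY hsys => by
    obtain ⟨i, hi⟩ := Function.ne_iff.1 hXY
    exact hFind i _ (X i).2 _ (Y i).2 (fun e => hi (Subtype.ext e))
      (hsys.of_reducesTo (hA X i) (hA Y i))
  simpa [hF] using this

theorem exists_fromRows_rightInverse {p m l n : ℕ} [Fact p.Prime] (hn : m + l = n)
    {v : Fin m → Fin n → ZMod p} (hv : IsUnimodular v) :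
    ∃ (W : Matrix (Fin l) (Fin n) (ZMod p)) (B : Matrix (Fin n) (Fin m ⊕ Fin l) (ZMod p)),
      fromRows (Matrix.of v) W * B = 1 := by
  have hlin := (isUnimodular_iff_linearIndependent v).1 hv
  obtain ⟨Q, hQ⟩ := (Submodule.span (ZMod p) (Set.range v)).exists_isCompl
  have hfin : Module.finrank (ZMod p) Q = l := by
    have h1 := Submodule.finrank_add_eq_of_isCompl hQ
    rw [finrank_span_eq_card hlin, Module.finrank_fintype_fun_eq_card, Fintype.card_fin,
      Fintype.card_fin] at h1
    omega
  let b := Module.finBasisOfFinrankEq (ZMod p) Q hfin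
  have hb : LinearIndependent (ZMod p) fun i => (b i : Fin n → ZMod p) :=
    b.linearIndependent.map' Q.subtype Q.ker_subtype
  have hspan : Submodule.span (ZMod p) (Set.range fun i => (b i : Fin n → ZMod p)) ≤ Q :=
    Submodule.span_le.2 (by rintro _ ⟨i, rfl⟩; exact (b i).2)
  have hsum := hlin.sum_type hb (hQ.disjoint.mono_right hspan)
  refine ⟨Matrix.of fun i => (b i : Fin n → ZMod p),
    exists_rightInverse_of_linearIndependent _ ?_⟩
  have hrow : (fromRows (Matrix.of v) (Matrix.of fun i => (b i : Fin n → ZMod p))).row =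
      Sum.elim v fun i => (b i : Fin n → ZMod p) := by
    ext i j
    rcases i with i | i <;> rfl
  rw [hrow]
  exact hsum

theorem exists_rightInverse_of_castHom_prime_pow {p s : ℕ} (hp : p.Prime) (hs : s ≠ 0)
    {κ μ : Type*} [Fintype κ] [Fintype μ] [DecidableEq κ] (M : Matrix κ μ (ZMod (p ^ s)))
    (hM : ∃ B : Matrix μ κ (ZMod p),
      M.map (ZMod.castHom (dvd_pow_self p hs) (ZMod p)) * B = 1) :
    ∃ B : Matrix μ κ (ZMod (p ^ s)), M * B = 1 := by
  have : NeZero (p ^ s) := ⟨pow_ne_zero _ hp.ne_zero⟩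
  exact exists_rightInverse_of_forall_castHom (ι := Unit) (p := fun _ => p)
    (fun i j hij => (hij (Subsingleton.elim _ _)).elim) (fun _ => dvd_pow_self p hs)
    (fun q hq hd => ⟨(), hq.dvd_of_dvd_pow hd⟩) M fun _ => hM

/-- Every `m`-subspace over `ℤ_p` has many lifts to `ℤ_{p^(e+1)}` that meet pairwise in dimension
less than `k`. -/
theorem exists_lifts {p e m l n k : ℕ} [hp : Fact p.Prime] (hl : l ≠ 0) (hml : m ≤ l)
    (hn : m + l = n) (X : Vertex m n p) :
    ∃ A : (Fin (l * k) → Fin (p ^ e)) → Vertex m n (p ^ (e + 1)),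
      (∀ c, ReducesTo (ZMod.castHom (dvd_pow_self p e.succ_ne_zero) (ZMod p)) (A c).1 X.1) ∧
      ∀ c d, HasSystem k ((A c).1 ⊓ (A d).1) → c = d := by
  classical
  obtain ⟨X, v, hv, rfl⟩ := X
  set f := ZMod.castHom (dvd_pow_self p e.succ_ne_zero) (ZMod p)
  have hfsurj : Function.Surjective f := ZMod.castHom_surjective _
  obtain ⟨E, hE⟩ := exists_integral_rank_code p hl hml k
  obtain ⟨W₀, B₀, hB₀⟩ := exists_fromRows_rightInverse hn hv
  choose V hV using fun i j => hfsurj (v i j)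
  choose W hW using fun i j => hfsurj (W₀ i j)
  obtain ⟨B, hB⟩ := exists_rightInverse_of_castHom_prime_pow hp.out e.succ_ne_zero
    (fromRows (Matrix.of V) (Matrix.of W)) ⟨B₀, by
      rw [← hB₀]
      congr 1
      ext i j
      rcases i with i | i
      · exact hV i j
      · exact hW i j⟩
  -- `B₁` reads off the `V`-coordinates and `B₂` the `W`-coordinates. The block `W * V⁻¹ = 0` and
  -- its mirror need a two-sided view only through `(V; W) * B = 1`.
  rw [← fromCols_toCols B, fromRows_mul_fromCols, ← fromBlocks_one, fromBlocks_inj] at hB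
  obtain ⟨hB11, hB12, hB21, hB22⟩ := hB
  set B₁ := B.toCols₁
  set B₂ := B.toCols₂
  let ec (c : Fin (l * k) → Fin (p ^ e)) : Matrix (Fin m) (Fin l) (ZMod (p ^ (e + 1))) :=
    (E fun b => ((c b : ℕ) : ℤ)).map (Int.cast)
  let T (c : Fin (l * k) → Fin (p ^ e)) : Matrix (Fin m) (Fin n) (ZMod (p ^ (e + 1))) :=
    Matrix.of V + (p : ZMod (p ^ (e + 1))) • (ec c * Matrix.of W)
  have hT (c) (i j) : f (T c i j) = v i j := by
    simp [T, hV]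
  have hT1 (c) : T c * B₁ = 1 := by
    simp [T, Matrix.add_mul, hB11, Matrix.mul_assoc, hB21]
  have hT2 (c) : T c * B₂ = (p : ZMod (p ^ (e + 1))) • ec c := by
    simp [T, Matrix.add_mul, hB12, Matrix.mul_assoc, hB22]
  refine ⟨fun c => ⟨Submodule.span _ (Set.range (T c)), T c, ⟨B₁, hT1 c⟩, rfl⟩,
    fun c => reducesTo_span f (hT c), ?_⟩
  rintro c d ⟨u, ⟨D, hD⟩, hu⟩
  have hmem (c) (x : Fin n → ZMod (p ^ (e + 1)))
      (hx : x ∈ Submodule.span (ZMod (p ^ (e + 1))) (Set.range (T c))) :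
      ∃ y : Fin m → ZMod (p ^ (e + 1)), y ᵥ* T c = x := by
    have := range_vecMulLinear (T c)
    change _ = Submodule.span _ (Set.range (T c)) at this
    rwa [← this, LinearMap.mem_range] at hx
  choose y hy using fun i => hmem c (u i) (hu i).1
  choose z hz using fun i => hmem d (u i) (hu i).2
  have hy' : Matrix.of y * T c = Matrix.of u := by ext i j; exact congrFun (hy i) j
  have hz' : Matrix.of z * T d = Matrix.of u := by ext i j; exact congrFun (hz i) j
  -- Since every `T c` has the same right inverse `B₁`, the shared vectors have equal coordinates in
  -- both bases; `B₂` then compares the codewords.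
  have hyz : Matrix.of y = Matrix.of z := by
    have := congrArg (fun M => M * B₁) (hy'.trans hz'.symm)
    simpa only [Matrix.mul_assoc, hT1, Matrix.mul_one] using this
  have hdiff : (p : ZMod (p ^ (e + 1))) • (Matrix.of y * (ec c - ec d)) = 0 := by
    have := congrArg (fun M => M * B₂) (hy'.trans hz'.symm)
    simp only [Matrix.mul_assoc, hT2, ← hyz, Matrix.mul_smul] at this
    rw [Matrix.mul_sub, smul_sub, this, sub_self]
  choose x hx using fun i j => ZMod.intCast_surjective (y i j)
  have hxy : (Matrix.of x).map (Int.cast : ℤ → ZMod (p ^ (e + 1))) = Matrix.of y := by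
    ext i j; exact hx i j
  have hdvd := hE (Matrix.of x) ?_ e (fun b => ((c b : ℕ) : ℤ) - ((d b : ℕ) : ℤ)) ?_
  -- The entries of `c` and `d` lie in `[0, p^e)`, so divisibility of their difference by `p^e`
  -- means equality.
  · ext b
    have h1 := Int.eq_zero_of_abs_lt_dvd (hdvd b) ?_
    · omega
    · have hc := (c b).2
      have hd := (d b).2
      rw [abs_lt]
      zify at hc hd
      constructor <;> omega
  · refine ⟨(T c * D).map f, ?_⟩
    have h1 : Matrix.of y * (T c * D) = 1 := by rw [← Matrix.mul_assoc, hy', hD]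
    have h2 := congrArg (fun M => M.map f) h1
    simp only [Matrix.map_mul, Matrix.map_one f f.map_zero f.map_one] at h2
    rw [← h2, ← hxy, Matrix.map_mul]
    congr 1
    ext i j
    simp
  · intro i j
    have h1 : ((p * (Matrix.of x * E fun b => ((c b : ℕ) : ℤ) - ((d b : ℕ) : ℤ)) i j : ℤ) :
        ZMod (p ^ (e + 1))) = 0 := by
      have h2 : (Matrix.of x * E fun b => ((c b : ℕ) : ℤ) - ((d b : ℕ) : ℤ)).map
          (Int.castRingHom (ZMod (p ^ (e + 1)))) = Matrix.of y * (ec c - ec d) := by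
        rw [Matrix.map_mul, ← hxy]
        congr 1
        rw [show (fun b => ((c b : ℕ) : ℤ) - ((d b : ℕ) : ℤ)) =
          (fun b => ((c b : ℕ) : ℤ)) - fun b => ((d b : ℕ) : ℤ) from rfl, map_sub]
        ext i j
        simp [ec]
      have h3 := congrFun (congrFun hdiff i) j
      rw [← h2] at h3
      push_cast
      simpa using h3
    -- One factor of `p^(e+1)` is spent on the `p` in front of `E(c)`, leaving `p^e`.
    rw [ZMod.intCast_zmod_eq_zero_iff_dvd, Nat.cast_pow, pow_succ', mul_dvd_mul_iff_left
      (by exact_mod_cast hp.out.ne_zero)] at h1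
    exact h1

theorem pow_mul_indepNum_le {p s r m n : ℕ} (hp : p.Prime) (hs : 1 ≤ s) (hr : 1 ≤ r)
    (hrm : r ≤ m + 1) (hmn : m + 1 ≤ n) (hn : 2 * m ≤ n) :
    p ^ ((s - 1) * (n - m) * (m + 1 - r)) * (grassmannGraph r m n p).indepNum ≤
      (grassmannGraph r m n (p ^ s)).indepNum := by
  classical
  have : Fact p.Prime := ⟨hp⟩
  obtain ⟨e, rfl⟩ := Nat.exists_eq_add_of_le' hs
  obtain ⟨F, hF, hFind⟩ := exists_independent (n := n) hp.one_lt hrm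
  choose A hA hAeq using fun X : F =>
    exists_lifts (e := e) (k := m + 1 - r) (show n - m ≠ 0 by omega) (by omega) (by omega) X.1
  have := card_le_indepNum (Nat.one_lt_pow e.succ_ne_zero hp.one_lt) hr hrm
    (fun x : F × (Fin ((n - m) * (m + 1 - r)) → Fin (p ^ e)) => A x.1 x.2) ?_
  · rw [Fintype.card_prod, Fintype.card_fun, Fintype.card_fin, Fintype.card_fin,
      Fintype.card_coe, hF, ← pow_mul, ← mul_assoc, mul_comm] at this
    exact this
  · rintro ⟨X, c⟩ ⟨Y, d⟩ hne hsys
    by_cases hXY : X = Y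
    · subst hXY
      exact hne (by rw [hAeq X c d hsys])
    · exact hFind X X.2 Y Y.2 (fun h => hXY (Subtype.ext h))
        (hsys.of_reducesTo (hA X c) (hA Y d))

end Lifting

end GrassmannZMod

theorem theorem5p2 (t : ℕ) (ht : 1 ≤ t) (p s : Fin t → ℕ)
    (hp : ∀ i, (p i).Prime) (hp_inj : Function.Injective p) (hs : ∀ i, 1 ≤ s i)
    (h : ℕ) (hh : h = ∏ i, p i ^ s i)
    (r m n : ℕ) (hr : 2 ≤ r) (hrm : r ≤ m + 1) (hmn : m + 1 ≤ n) (hn : 2 * m ≤ n) :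
    (∏ i, p i ^ ((s i - 1) * (n - m) * (m + 1 - r)) *
        (GrassmannZMod.grassmannGraph r m n (p i)).indepNum
      ≤ (GrassmannZMod.grassmannGraph r m n h).indepNum) ∧
    (((GrassmannZMod.grassmannGraph r m n h).indepNum : ℚ)
      ≤ ∏ i, ((p i : ℚ) ^ ((s i - 1) * (n - m) * (m + 1 - r)) *
          GrassmannZMod.gaussBinom (p i) n m /
            GrassmannZMod.gaussBinom (p i) (n - m + r - 1) (r - 1))) := by
  subst hh
  have : Nonempty (Fin t) := ⟨⟨0, ht⟩⟩
  constructor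
  · exact (Finset.prod_le_prod' fun i _ => GrassmannZMod.pow_mul_indepNum_le (hp i) (hs i)
      (by omega) hrm hmn hn).trans
        (GrassmannZMod.prod_indepNum_le hp hp_inj hs (by omega) hrm)
  · exact GrassmannZMod.indepNum_le hp hp_inj hs (by omega) hrm (by omega)
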